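/- In \emph{online set cover with multiple costs}, the offline input consists of a finite ground set $U$ with $r=|U|$ elements, sets $S_1,\dots,S_n\subseteq U$, and $K$ linear cost functions given by $B_k:[n]\to\mathbb{R}_{\ge 0}$, $k\in[K]$; a sub-collection $T\subseteq[n]$ has the costs $B_k(T)=\sum_{j\in T}B_k(j)$ and the objective value $\mathrm{cost}_p(T)=\bigl(\sum_{k=1}^K B_k(T)^p\bigr)^{1/p}$, where $p\ge 1$ is real. Elements of $U$ (each lying in at least one set) arrive online one by one; each must be covered by a selected set upon arrival, and selecting a set is irrevocable. A randomized online algorithm knows $p$ and the offline input, and its selection at any time may depend only on the elements that have arrived so far and on its random seed. It is $\alpha$-competitive if for every request sequence $\sigma=(e_1,\dots,e_m)$ of such elements, fixed independently of the random seed, the collection $T(\sigma)$ selected after $\sigma$ satisfies $$\mathbb{E}\bigl[\mathrm{cost}_p(T(\sigma))\bigr]\;\le\;\alpha\cdot\min\bigl\{\mathrm{cost}_p(T): T\subseteq[n],\ \{e_1,\dots,e_m\}\subseteq\textstyle\bigcup_{j\in T}S_j\bigr\}.$$ \textbf{Theorem.} There is an absolute constant $C>0$ and a randomized online algorithm for this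 problem which, for every real $p\ge 1$ and every offline input, is $\alpha$-competitive with $$\alpha \;=\; C\cdot\frac{p^3}{\log(1+p)}\cdot\log(1+d)\cdot\log(1+r),$$ where $d$ is the maximum number of sets containing any one element and $r=|U|$. In particular, the competitive ratio is $O\bigl(\frac{p^3}{\log p}\log d\log r\bigr)$ for $p>1$ and $d,r\ge 2$, and $O(\log d\log r)$ for $p=1$ and $d,r\ge 2$. -/

import Mathlib

open MeasureTheory
open scoped NNReal

noncomputable section

/-- The offline input of online set cover with multiple costs: a ground set `U = Fin r` of `r`
elements, `n` sets `S j ⊆ U`, and `K` linear cost functions `B k : [n] → ℝ₊`. -/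
structure SetCoverInstance where
  /-- the number `r = |U|` of elements -/
  r : ℕ
  /-- the number of sets -/
  n : ℕ
  /-- the number of cost functions -/
  K : ℕ
  /-- the sets -/
  S : Fin n → Finset (Fin r)
  /-- the cost functions; `B k j` is the cost of the set `j` under the `k`-th one -/
  B : Fin K → Fin n → ℝ≥0

namespace SetCoverInstance

variable (I : SetCoverInstance)

/-- The maximum, over all elements `e ∈ U`, of the number of sets that contain `e`. -/
def d : ℕ :=
  Finset.univ.sup fun e : Fin I.r => (Finset.univ.filter fun j : Fin I.n => e ∈ I.S j).card

/-- The objective: the `ℓ_p`-norm of the vector of the `K` costs of the sub-collection `T`. -/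
def cost (p : ℝ) (T : Finset (Fin I.n)) : ℝ :=
  (∑ k : Fin I.K, (∑ j ∈ T, (I.B k j : ℝ)) ^ p) ^ (1 / p)

/-- The element `e` lies in some set of the sub-collection `T`. -/
def Covers (T : Finset (Fin I.n)) (e : Fin I.r) : Prop :=
  ∃ j ∈ T, e ∈ I.S j

/-- A request sequence is feasible if each of its elements lies in at least one set. -/
def Feasible (σ : List (Fin I.r)) : Prop :=
  ∀ e ∈ σ, ∃ j, e ∈ I.S j

/-- The offline optimum: the least cost of a sub-collection that covers every element of the
request sequence `σ` (a minimum over a finite set, which is nonempty if `σ` is feasible). -/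
def opt (p : ℝ) (σ : List (Fin I.r)) : ℝ :=
  sInf {c : ℝ | ∃ T : Finset (Fin I.n), (∀ e ∈ σ, I.Covers T e) ∧ c = I.cost p T}

end SetCoverInstance

/-- A randomized online algorithm on the offline input `I`: a probability space of random seeds
and, for each seed, a deterministic online algorithm. The sets selected so far depend only on the
seed and on the requests that have arrived so far (listed in order of arrival). -/
structure RandomizedOnlineSetCover (I : SetCoverInstance) where
  /-- the random seeds -/
  Ω : Type
  [measurableSpace : MeasurableSpace Ω]
  /-- the law of the random seed -/
  P : Measure Ω
  [isProbabilityMeasure : IsProbabilityMeasure P]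
  /-- the sets that have been selected after the given requests -/
  select : List (Fin I.r) → Ω → Finset (Fin I.n)
  measurable_select : ∀ (σ : List (Fin I.r)) (j : Fin I.n), MeasurableSet {ω | j ∈ select σ ω}
  /-- selections are irrevocable -/
  irrevocable : ∀ (σ : List (Fin I.r)) (e : Fin I.r) (ω : Ω),
    select σ ω ⊆ select (σ ++ [e]) ω
  /-- an element that lies in some set is covered upon its arrival -/
  covers_arrival : ∀ (σ : List (Fin I.r)) (e : Fin I.r) (ω : Ω), (∃ j, e ∈ I.S j) →
    I.Covers (select (σ ++ [e]) ω) e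

namespace RandomizedOnlineSetCover

variable {I : SetCoverInstance} (A : RandomizedOnlineSetCover I)

/-- The expected `ℓ_p`-objective of the solution held after the requests `σ`. (The integrand is
measurable and takes finitely many values, so it is integrable.) -/
def expectedCost (p : ℝ) (σ : List (Fin I.r)) : ℝ :=
  letI := A.measurableSpace
  ∫ ω, I.cost p (A.select σ ω) ∂A.P

/-- `A` is `α`-competitive for the `ℓ_p`-objective, against every feasible request sequence that is
fixed independently of the random seed. -/
def IsCompetitive (p α : ℝ) : Prop :=
  ∀ σ : List (Fin I.r), I.Feasible σ → A.expectedCost p σ ≤ α * I.opt p σ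

end RandomizedOnlineSetCover

end

/-! A monotone fractional solution is maintained online and rounded with independent thresholds
fixed in advance.

Fractional part. The potential `energy` is the sum of the `p`-th powers of the loads plus a linear
term in the sets' own `p`-th powers; the linear term is what the rounding needs later. When `e`
arrives, each set containing `e` grows at rate `(x j + 1/d) / grad j`. The potential then rises at
rate at most 2, since the `x j` sum to less than 1 and there are at most `d` of them. Meanwhile `log
(x j + 1/d)` rises at rate `1 / grad j` for every such `j`, in particular for one chosen by the
offline solution `T`. Charging each arrival to that set and telescoping bounds the potential by a
multiple of `log (1 + d)` times the sum of the gradients over `T`. A Young-type inequality absorbs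
the potential back into the left side (`energy_fractional_le`).

Rounding. A set is taken once its scaled fractional value exceeds its threshold. A Rosenthal-type
bound for sums of independent Bernoulli variables (`integral_rpow_sum_bernoulli_le`) has exactly the
two terms of `energy`, so the expected `p`-th power of the cost is controlled by the potential, and
Jensen removes the power. The scale `2 log (1 + r)` makes each element missed with probability at
most `1 / (1 + r)`; repairing a miss by a cheapest set costs at most the optimum, so all repairs
together add at most one optimum in expectation.

Each half loses a factor `p`; the resulting `p ^ 2` is stronger than the stated `p ^ 3 / log (1 +
p)`. -/

/-! ### Inequalities for real powers -/

theorem Real.rpow_sub_one_mul_self {p v : ℝ} (hp : 1 ≤ p) (hv : 0 ≤ v) :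
    v ^ (p - 1) * v = v ^ p := by
  rw [← Real.rpow_add_one' hv (by linarith)]
  congr 1
  ring

/-- Young's inequality with crude constants: compare `M * u` with `v`. The free parameter `M` makes
the `v ^ p` term small enough to be absorbed. -/
theorem Real.mul_rpow_sub_one_le {p u v M : ℝ} (hp : 1 ≤ p) (hu : 0 ≤ u) (hv : 0 ≤ v)
    (hM : 0 < M) : u * v ^ (p - 1) ≤ v ^ p / M + M ^ (p - 1) * u ^ p := by
  have hp' : 0 ≤ p - 1 := by linarith
  have h1 : 0 ≤ v ^ p / M := by positivity
  have h2 : 0 ≤ M ^ (p - 1) * u ^ p := by positivity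
  rcases le_total (M * u) v with h | h
  · have : u * v ^ (p - 1) ≤ v / M * v ^ (p - 1) := by
      gcongr
      rw [le_div_iff₀ hM]
      linarith
    have h3 : v / M * v ^ (p - 1) = v ^ p / M := by
      rw [← Real.rpow_sub_one_mul_self hp hv]
      ring
    linarith
  · have : u * v ^ (p - 1) ≤ u * (M * u) ^ (p - 1) := by gcongr
    have h3 : u * (M * u) ^ (p - 1) = M ^ (p - 1) * u ^ p := by
      rw [Real.mul_rpow hM.le hu, ← Real.rpow_sub_one_mul_self hp hu]
      ring
    linarith

/-- If `s ≥ p * b`, adding `b` multiplies `s` by at most `exp (1 / p)`, hence its `(p - 1)`-th power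
by at most `e < 3`. Otherwise `s + b ≤ (p + 1) * b`. -/
theorem Real.mul_add_rpow_sub_one_le {p b s : ℝ} (hp : 1 ≤ p) (hb : 0 ≤ b) (hs : 0 ≤ s) :
    b * (s + b) ^ (p - 1) ≤ 3 * (b * s ^ (p - 1)) + (p + 1) ^ (p - 1) * b ^ p := by
  have hp' : 0 ≤ p - 1 := by linarith
  have hp0 : 0 < p := by linarith
  have h1 : 0 ≤ b * s ^ (p - 1) := by positivity
  have h2 : 0 ≤ (p + 1) ^ (p - 1) * b ^ p := by positivity
  rcases le_total (p * b) s with h | h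
  · have hexp : s + b ≤ Real.exp (1 / p) * s := by
      have := Real.add_one_le_exp (1 / p)
      have h4 : b ≤ 1 / p * s := by
        rw [one_div, ← div_eq_inv_mul, le_div_iff₀ hp0]
        linarith
      nlinarith
    have h5 : Real.exp (1 / p) ^ (p - 1) ≤ 3 := by
      rw [← Real.exp_mul]
      refine le_trans (Real.exp_le_exp.2 ?_) Real.exp_one_lt_three.le
      rw [one_div, ← div_eq_inv_mul, div_le_one hp0]
      linarith
    calc b * (s + b) ^ (p - 1) ≤ b * (Real.exp (1 / p) * s) ^ (p - 1) := by gcongr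
      _ = Real.exp (1 / p) ^ (p - 1) * (b * s ^ (p - 1)) := by
        rw [Real.mul_rpow (Real.exp_pos _).le hs]
        ring
      _ ≤ 3 * (b * s ^ (p - 1)) := by gcongr
      _ ≤ _ := by linarith
  · calc b * (s + b) ^ (p - 1) ≤ b * ((p + 1) * b) ^ (p - 1) := by
          gcongr
          linarith
      _ = (p + 1) ^ (p - 1) * b ^ p := by
        rw [Real.mul_rpow (by linarith) hb, ← Real.rpow_sub_one_mul_self hp hb]
        ring
      _ ≤ _ := by linarith

theorem Real.sum_rpow_le_rpow_sum {ι : Type*} {p : ℝ} (hp : 1 ≤ p) (s : Finset ι) {f : ι → ℝ}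
    (hf : ∀ i, 0 ≤ f i) : ∑ i ∈ s, f i ^ p ≤ (∑ i ∈ s, f i) ^ p := by
  classical
  induction s using Finset.induction_on with
  | empty => simp [Real.zero_rpow (by linarith : p ≠ 0)]
  | insert a s ha ih =>
    rw [Finset.sum_insert ha, Finset.sum_insert ha]
    have := Real.add_rpow_le_rpow_add (hf a) (Finset.sum_nonneg fun i (_ : i ∈ s) => hf i) hp
    linarith

/-! ### A Rosenthal-type moment bound -/

section Moments

open ProbabilityTheory

variable {Ω ι : Type*} [MeasurableSpace Ω] {μ : Measure Ω} [IsProbabilityMeasure μ] [Fintype ι]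

/-- A moment bound for weighted sums of independent Bernoulli variables. -/
theorem integral_rpow_sum_bernoulli_le {p : ℝ} (hp : 1 ≤ p) {X : ι → Ω → ℝ}
    (hind : iIndepFun X μ) (hmeas : ∀ i, Measurable (X i)) (h01 : ∀ i ω, X i ω = 0 ∨ X i ω = 1)
    {b : ι → ℝ} (hb : ∀ i, 0 ≤ b i) :
    ∫ ω, (∑ i, b i * X i ω) ^ p ∂μ ≤ 6 ^ p * (∑ i, b i * ∫ ω, X i ω ∂μ) ^ p +
      2 * (p + 1) ^ (p - 1) * ∑ i, b i ^ p * ∫ ω, X i ω ∂μ := by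
  classical
  have hp' : 0 ≤ p - 1 := by linarith
  have hp0 : 0 ≤ p := by linarith
  have hX0 : ∀ i ω, 0 ≤ X i ω := fun i ω => by rcases h01 i ω with h | h <;> simp [h]
  have hX1 : ∀ i ω, X i ω ≤ 1 := fun i ω => by rcases h01 i ω with h | h <;> simp [h]
  set S : Ω → ℝ := fun ω => ∑ i, b i * X i ω with hS
  set R : ι → Ω → ℝ := fun i ω => ∑ j ∈ Finset.univ.erase i, b j * X j ω with hR
  have hSm : Measurable S := by fun_prop
  have hRm : ∀ i, Measurable (R i) := fun i => by fun_prop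
  have hS0 : ∀ ω, 0 ≤ S ω := fun ω =>
    Finset.sum_nonneg fun i _ => mul_nonneg (hb i) (hX0 i ω)
  have hR0 : ∀ i ω, 0 ≤ R i ω := fun i ω =>
    Finset.sum_nonneg fun i _ => mul_nonneg (hb i) (hX0 i ω)
  have hRS : ∀ i ω, R i ω ≤ S ω := fun i ω =>
    Finset.sum_le_sum_of_subset_of_nonneg (Finset.erase_subset _ _)
      fun i _ _ => mul_nonneg (hb i) (hX0 i ω)
  have hsplit : ∀ i ω, b i * X i ω + R i ω = S ω := fun i ω =>
    Finset.add_sum_erase Finset.univ (fun j => b j * X j ω) (Finset.mem_univ i)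
  set D := ∑ i, b i with hD
  have hSD : ∀ ω, S ω ≤ D := fun ω => Finset.sum_le_sum fun i _ =>
    mul_le_of_le_one_right (hb i) (hX1 i ω)
  have hint : ∀ (Y : Ω → ℝ) (C s : ℝ), Measurable Y → (∀ ω, 0 ≤ Y ω) → (∀ ω, Y ω ≤ C) → 0 ≤ s →
      Integrable (fun ω => Y ω ^ s) μ := by
    intro Y C s hY h0 hC hs
    refine Integrable.of_bound (hY.pow_const s).aestronglyMeasurable (C ^ s)
      (Filter.Eventually.of_forall fun ω => ?_)
    rw [Real.norm_of_nonneg (Real.rpow_nonneg (h0 ω) _)]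
    exact Real.rpow_le_rpow (h0 ω) (hC ω) hs
  have hXint : ∀ i, Integrable (X i) μ := fun i =>
    Integrable.of_bound (hmeas i).aestronglyMeasurable 1
      (Filter.Eventually.of_forall fun ω => by
        rw [Real.norm_of_nonneg (hX0 i ω)]; exact hX1 i ω)
  set q : ι → ℝ := fun i => ∫ ω, X i ω ∂μ with hq
  have hq0 : ∀ i, 0 ≤ q i := fun i => integral_nonneg (hX0 i)
  have hiS := hint S D p hSm hS0 hSD hp0
  have hiS' := hint S D (p - 1) hSm hS0 hSD hp'
  have hiR : ∀ i, Integrable (fun ω => (R i ω + b i) ^ (p - 1)) μ := fun i =>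
    hint _ (D + b i) (p - 1) ((hRm i).add_const _) (fun ω => add_nonneg (hR0 i ω) (hb i))
      (fun ω => by linarith [hRS i ω, hSD ω]) hp'
  have hiSb : ∀ i, Integrable (fun ω => (S ω + b i) ^ (p - 1)) μ := fun i =>
    hint _ (D + b i) (p - 1) (hSm.add_const _) (fun ω => add_nonneg (hS0 ω) (hb i))
      (fun ω => by linarith [hSD ω]) hp'
  have hindep : ∀ i, IndepFun (X i) (fun ω => (R i ω + b i) ^ (p - 1)) μ := by
    intro i
    -- Leaving the `i`-th variable unscaled puts `X i` and the weighted sum of the others into one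
    -- independent family.
    have h1 : iIndepFun (fun j ω => if j = i then X j ω else b j * X j ω) μ := by
      have := hind.comp (fun j x => if j = i then x else b j * x) (fun j => by
        by_cases h : j = i <;> simp only [h, if_true, if_false] <;> fun_prop)
      exact this
    have h2 := h1.indepFun_finsetSum_of_notMem (fun j => by
      by_cases h : j = i <;> simp only [h, if_true, if_false] <;> fun_prop)
      (Finset.notMem_erase i Finset.univ)
    have h3 := h2.symm.comp measurable_id
      ((measurable_id.add_const (b i)).pow_const (p - 1))
    convert h3 using 1
    · ext ω; simp
    · ext ω
      simp only [Function.comp, id, Finset.sum_apply, hR]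
      congr 2
      exact Finset.sum_congr rfl fun j hj => by rw [if_neg (Finset.ne_of_mem_erase hj)]
  -- On `X i = 1` the sum equals `R i + b i`, which is independent of `X i`, so the expectation
  -- factors.
  have hterm : ∀ i, ∫ ω, X i ω * S ω ^ (p - 1) ∂μ ≤ q i * ∫ ω, (S ω + b i) ^ (p - 1) ∂μ := by
    intro i
    have h1 : ∀ ω, X i ω * S ω ^ (p - 1) = X i ω * (R i ω + b i) ^ (p - 1) := by
      intro ω
      rcases h01 i ω with h | h
      · simp [h]
      · rw [← hsplit i ω, h, mul_one, add_comm]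
    rw [integral_congr_ae (Filter.Eventually.of_forall h1),
      (hindep i).integral_fun_mul_eq_mul_integral (hmeas i).aestronglyMeasurable
        (hiR i).aestronglyMeasurable]
    refine mul_le_mul_of_nonneg_left (integral_mono (hiR i) (hiSb i) fun ω => ?_) (hq0 i)
    exact Real.rpow_le_rpow (add_nonneg (hR0 i ω) (hb i)) (by linarith [hRS i ω]) hp'
  have hiXS : ∀ i, Integrable (fun ω => X i ω * S ω ^ (p - 1)) μ := fun i =>
    hiS'.bdd_mul (c := 1) (hmeas i).aestronglyMeasurable
      (Filter.Eventually.of_forall fun ω => by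
        rw [Real.norm_of_nonneg (hX0 i ω)]; exact hX1 i ω)
  set A := ∫ ω, S ω ^ p ∂μ with hA
  set A' := ∫ ω, S ω ^ (p - 1) ∂μ with hA'
  set m := ∑ i, b i * q i with hm
  have hm0 : 0 ≤ m := Finset.sum_nonneg fun i _ => mul_nonneg (hb i) (hq0 i)
  have e1 : A = ∑ i, b i * ∫ ω, X i ω * S ω ^ (p - 1) ∂μ := by
    simp_rw [← integral_const_mul]
    rw [← integral_finsetSum _ fun i _ => (hiXS i).const_mul (b i)]
    refine integral_congr_ae (Filter.Eventually.of_forall fun ω => ?_)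
    simp only
    rw [← Real.rpow_sub_one_mul_self hp (hS0 ω)]
    conv_lhs => rw [mul_comm]; arg 1; rw [hS]
    rw [Finset.sum_mul]
    exact Finset.sum_congr rfl fun i _ => by ring
  have e2 : ∀ i, b i * ∫ ω, (S ω + b i) ^ (p - 1) ∂μ ≤
      3 * (b i * A') + (p + 1) ^ (p - 1) * b i ^ p := by
    intro i
    have h1 : ∫ ω, b i * (S ω + b i) ^ (p - 1) ∂μ ≤
        ∫ ω, (3 * (b i * S ω ^ (p - 1)) + (p + 1) ^ (p - 1) * b i ^ p) ∂μ :=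
      integral_mono ((hiSb i).const_mul _)
        (((hiS'.const_mul (b i)).const_mul 3).add (integrable_const _))
        fun ω => Real.mul_add_rpow_sub_one_le hp (hb i) (hS0 ω)
    rw [integral_const_mul, integral_add ((hiS'.const_mul (b i)).const_mul 3)
      (integrable_const _), integral_const_mul, integral_const_mul] at h1
    simpa using h1
  have e3 : A ≤ 3 * (m * A') + (p + 1) ^ (p - 1) * ∑ i, b i ^ p * q i := by
    rw [e1]
    calc ∑ i, b i * ∫ ω, X i ω * S ω ^ (p - 1) ∂μ
        ≤ ∑ i, q i * (3 * (b i * A') + (p + 1) ^ (p - 1) * b i ^ p) := by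
          refine Finset.sum_le_sum fun i _ => ?_
          calc _ ≤ b i * (q i * ∫ ω, (S ω + b i) ^ (p - 1) ∂μ) :=
                mul_le_mul_of_nonneg_left (hterm i) (hb i)
            _ = q i * (b i * ∫ ω, (S ω + b i) ^ (p - 1) ∂μ) := by ring
            _ ≤ _ := mul_le_mul_of_nonneg_left (e2 i) (hq0 i)
      _ = _ := by
        rw [hm, Finset.sum_mul, Finset.mul_sum, Finset.mul_sum, ← Finset.sum_add_distrib]
        exact Finset.sum_congr rfl fun i _ => by ring
  -- With parameter 6, the factor 3 in `e3` turns `A / 6` into `A / 2`, which moves to the left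
  -- side.
  have e4 : m * A' ≤ A / 6 + 6 ^ (p - 1) * m ^ p := by
    have h1 : ∫ ω, m * S ω ^ (p - 1) ∂μ ≤ ∫ ω, (S ω ^ p / 6 + 6 ^ (p - 1) * m ^ p) ∂μ :=
      integral_mono (hiS'.const_mul _) ((hiS.div_const _).add (integrable_const _))
        fun ω => Real.mul_rpow_sub_one_le hp hm0 (hS0 ω) (by norm_num)
    rw [integral_const_mul, integral_add (hiS.div_const _) (integrable_const _),
      integral_div] at h1
    simpa using h1
  have e5 : (6 : ℝ) ^ (p - 1) * 6 = 6 ^ p := Real.rpow_sub_one_mul_self hp (by norm_num)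
  rw [← e5]
  linarith

end Moments

/-! ### The potential and its gradient -/

namespace SetCoverInstance

variable (I : SetCoverInstance)

/-- The `k`-th cost of a fractional solution. -/
noncomputable def load (x : Fin I.n → ℝ) (k : Fin I.K) : ℝ := ∑ j, (I.B k j : ℝ) * x j

/-- The `p`-th power of the objective value of a single set. -/
noncomputable def weight (p : ℝ) (j : Fin I.n) : ℝ := ∑ k, (I.B k j : ℝ) ^ p

/-- The convex potential that the fractional algorithm keeps small. -/
noncomputable def energy (p : ℝ) (x : Fin I.n → ℝ) : ℝ := ∑ k, I.load x k ^ p + ∑ j, I.weight p j * x j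

/-- The partial derivatives of the potential. -/
noncomputable def grad (p : ℝ) (x : Fin I.n → ℝ) (j : Fin I.n) : ℝ :=
  p * ∑ k, (I.B k j : ℝ) * I.load x k ^ (p - 1) + I.weight p j

/-- The sets that contain a given element. -/
def setsOf (e : Fin I.r) : Finset (Fin I.n) := Finset.univ.filter fun j => e ∈ I.S j

variable {I}

@[simp]
theorem mem_setsOf {e : Fin I.r} {j : Fin I.n} : j ∈ I.setsOf e ↔ e ∈ I.S j := by simp [setsOf]

theorem card_setsOf_le (e : Fin I.r) : (I.setsOf e).card ≤ I.d :=
  Finset.le_sup (f := fun e : Fin I.r => (Finset.univ.filter fun j => e ∈ I.S j).card)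
    (Finset.mem_univ e)

theorem d_pos {e : Fin I.r} {j : Fin I.n} (h : e ∈ I.S j) : 0 < I.d :=
  (Finset.card_pos.2 ⟨j, mem_setsOf.2 h⟩).trans_le (card_setsOf_le e)

theorem load_mono {x y : Fin I.n → ℝ} (h : x ≤ y) (k : Fin I.K) : I.load x k ≤ I.load y k :=
  Finset.sum_le_sum fun j _ => mul_le_mul_of_nonneg_left (h j) (I.B k j).2

theorem load_nonneg {x : Fin I.n → ℝ} (h : 0 ≤ x) (k : Fin I.K) : 0 ≤ I.load x k :=
  Finset.sum_nonneg fun j _ => mul_nonneg (I.B k j).2 (h j)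

theorem weight_nonneg (p : ℝ) (j : Fin I.n) : 0 ≤ I.weight p j :=
  Finset.sum_nonneg fun _ _ => Real.rpow_nonneg (NNReal.coe_nonneg _) _

theorem weight_eq_zero_iff {p : ℝ} (hp : 1 ≤ p) {j : Fin I.n} :
    I.weight p j = 0 ↔ ∀ k, I.B k j = 0 := by
  rw [weight, Finset.sum_eq_zero_iff_of_nonneg fun _ _ => Real.rpow_nonneg (NNReal.coe_nonneg _) _]
  refine ⟨fun h k => ?_, fun h k _ => ?_⟩
  · have := h k (Finset.mem_univ k)
    rw [Real.rpow_eq_zero (NNReal.coe_nonneg _) (by linarith)] at this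
    exact_mod_cast this
  · rw [h k, NNReal.coe_zero, Real.zero_rpow (by linarith)]

theorem grad_mono {p : ℝ} (hp : 1 ≤ p) {x y : Fin I.n → ℝ} (hx : 0 ≤ x) (h : x ≤ y)
    (j : Fin I.n) : I.grad p x j ≤ I.grad p y j := by
  unfold grad
  gcongr with k _
  · exact load_nonneg hx k
  · exact load_mono h k

theorem weight_le_grad {p : ℝ} (hp : 1 ≤ p) {x : Fin I.n → ℝ} (hx : 0 ≤ x) (j : Fin I.n) :
    I.weight p j ≤ I.grad p x j := by
  have : 0 ≤ p * ∑ k, (I.B k j : ℝ) * I.load x k ^ (p - 1) :=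
    mul_nonneg (by linarith) (Finset.sum_nonneg fun k _ =>
      mul_nonneg (I.B k j).2 (Real.rpow_nonneg (load_nonneg hx k) _))
  unfold grad
  linarith

theorem grad_nonneg {p : ℝ} (hp : 1 ≤ p) {x : Fin I.n → ℝ} (hx : 0 ≤ x) (j : Fin I.n) :
    0 ≤ I.grad p x j := (weight_nonneg p j).trans (weight_le_grad hp hx j)

theorem continuous_load (k : Fin I.K) : Continuous fun x => I.load x k := by
  unfold load
  fun_prop

theorem continuous_energy {p : ℝ} (hp : 1 ≤ p) : Continuous (I.energy p) := by
  unfold energy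
  refine Continuous.add (continuous_finsetSum _ fun k _ => ?_) (by fun_prop)
  exact (continuous_load k).rpow_const fun _ => Or.inr (by linarith)

theorem continuous_grad {p : ℝ} (hp : 1 ≤ p) (j : Fin I.n) :
    Continuous fun x => I.grad p x j := by
  unfold grad
  refine (continuous_const.mul (continuous_finsetSum _ fun k _ => ?_)).add continuous_const
  exact continuous_const.mul ((continuous_load k).rpow_const fun _ => Or.inr (by linarith))

/-- Convexity, in the form of Bernoulli's inequality at `a / b - 1`. -/
theorem rpow_sub_rpow_le {p a b : ℝ} (hp : 1 ≤ p) (ha : 0 ≤ a) (hab : a ≤ b) :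
    b ^ p - a ^ p ≤ p * b ^ (p - 1) * (b - a) := by
  rcases (ha.trans hab).eq_or_lt with h | h
  · have : a = b := le_antisymm hab (h ▸ ha)
    simp [this]
  · have h1 := one_add_mul_self_le_rpow_one_add (s := a / b - 1)
      (by have : 0 ≤ a / b := by positivity
          linarith) hp
    rw [add_sub_cancel, Real.div_rpow ha h.le, le_div_iff₀ (by positivity)] at h1
    have h2 := Real.rpow_sub_one_mul_self hp h.le
    have h3 : (1 + p * (a / b - 1)) * b ^ p = b ^ p - p * b ^ (p - 1) * (b - a) := by
      rw [← h2]
      field_simp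
      ring
    linarith

/-- The potential grows at most by its gradient at the end point times the displacement. -/
theorem energy_sub_le {p : ℝ} (hp : 1 ≤ p) {x y : Fin I.n → ℝ} (hx : 0 ≤ x) (h : x ≤ y) :
    I.energy p y - I.energy p x ≤ ∑ j, I.grad p y j * (y j - x j) := by
  have h1 : ∀ k, I.load y k ^ p - I.load x k ^ p ≤
      ∑ j, p * ((I.B k j : ℝ) * I.load y k ^ (p - 1)) * (y j - x j) := by
    intro k
    refine (rpow_sub_rpow_le hp (load_nonneg hx k) (load_mono h k)).trans_eq ?_
    have : I.load y k - I.load x k = ∑ j, (I.B k j : ℝ) * (y j - x j) := by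
      unfold load
      rw [← Finset.sum_sub_distrib]
      exact Finset.sum_congr rfl fun j _ => by ring
    rw [this, Finset.mul_sum]
    exact Finset.sum_congr rfl fun j _ => by ring
  have h2 := Finset.sum_le_sum fun k (_ : k ∈ Finset.univ) => h1 k
  rw [Finset.sum_sub_distrib, Finset.sum_comm] at h2
  have h3 : ∑ j, I.grad p y j * (y j - x j) =
      (∑ j, ∑ k, p * ((I.B k j : ℝ) * I.load y k ^ (p - 1)) * (y j - x j)) +
        (∑ j, I.weight p j * y j - ∑ j, I.weight p j * x j) := by
    rw [← Finset.sum_sub_distrib, ← Finset.sum_add_distrib]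
    refine Finset.sum_congr rfl fun j _ => ?_
    rw [grad, Finset.mul_sum, add_mul, Finset.sum_mul]
    ring
  rw [h3]
  unfold energy
  linarith

/-! ### The online fractional algorithm -/

/-- The fractional solution `x` may be replaced by `y` when the element `e` arrives. -/
structure IsUpdate (p : ℝ) (e : Fin I.r) (x y : Fin I.n → ℝ) : Prop where
  le : x ≤ y
  le_one : y ≤ 1
  covers : 1 ≤ ∑ j ∈ I.setsOf e, y j
  energy_le : ∀ j ∈ I.setsOf e, I.energy p y - I.energy p x ≤
    8 * I.grad p y j * (Real.log (y j + 1 / I.d) - Real.log (x j + 1 / I.d))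

theorem log_sub_log_nonneg {δ a b : ℝ} (hδ : 0 < δ) (ha : 0 ≤ a) (hab : a ≤ b) :
    0 ≤ Real.log (b + δ) - Real.log (a + δ) :=
  sub_nonneg.2 (Real.log_le_log (by linarith) (by linarith))

/-- A discrete version of the continuous growth. The ideal constant 2 becomes 8: one factor 2 for
the drift of the gradient, another for `log (1 + u) ≥ u / 2`. -/
theorem exists_small_step {p : ℝ} (hp : 1 ≤ p) {e : Fin I.r} (he : ∃ j, e ∈ I.S j)
    {y : Fin I.n → ℝ} (hy0 : 0 ≤ y) (hsum : ∑ j ∈ I.setsOf e, y j < 1)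
    (hpos : ∀ j ∈ I.setsOf e, 0 < I.weight p j) :
    ∃ z, y ≤ z ∧ (∀ j ∉ I.setsOf e, z j = y j) ∧ ∑ j ∈ I.setsOf e, z j ≤ 1 ∧
      ∑ j ∈ I.setsOf e, y j < ∑ j ∈ I.setsOf e, z j ∧
      ∀ j ∈ I.setsOf e, I.energy p z - I.energy p y ≤
        8 * I.grad p z j * (Real.log (z j + 1 / I.d) - Real.log (y j + 1 / I.d)) := by
  obtain ⟨j0, hj0⟩ := he
  have hd : (0 : ℝ) < I.d := by exact_mod_cast d_pos hj0
  set δ : ℝ := 1 / I.d with hδ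
  have hδ0 : 0 < δ := by positivity
  have hg : ∀ j ∈ I.setsOf e, 0 < I.grad p y j := fun j hj =>
    (hpos j hj).trans_le (weight_le_grad hp hy0 j)
  set v : Fin I.n → ℝ := fun j => if j ∈ I.setsOf e then (y j + δ) / I.grad p y j else 0 with hv
  have hvmem : ∀ j ∈ I.setsOf e, v j = (y j + δ) / I.grad p y j := fun j hj => if_pos hj
  have hvoff : ∀ j ∉ I.setsOf e, v j = 0 := fun j hj => if_neg hj
  have hvpos : ∀ j ∈ I.setsOf e, 0 < v j := fun j hj => by
    rw [hvmem j hj]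
    have : 0 ≤ y j := hy0 j
    exact div_pos (by linarith) (hg j hj)
  have hv0 : 0 ≤ v := fun j => by
    by_cases hj : j ∈ I.setsOf e
    · exact (hvpos j hj).le
    · exact (hvoff j hj).ge
  have hcont : Continuous fun η : ℝ => y + η • v := by fun_prop
  have ev1 : ∀ᶠ η in nhds (0 : ℝ), ∑ j ∈ I.setsOf e, (y + η • v) j < 1 := by
    have : Continuous fun η : ℝ => ∑ j ∈ I.setsOf e, (y + η • v) j := by
      simp only [Pi.add_apply, Pi.smul_apply]
      fun_prop
    exact this.continuousAt.eventually_lt continuousAt_const (by simpa using hsum)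
  have ev2 : ∀ᶠ η in nhds (0 : ℝ), ∀ j ∈ I.setsOf e,
      I.grad p (y + η • v) j < 2 * I.grad p y j := by
    rw [Filter.eventually_all_finset]
    intro j hj
    have : Continuous fun η : ℝ => I.grad p (y + η • v) j := (continuous_grad hp j).comp hcont
    refine this.continuousAt.eventually_lt continuousAt_const ?_
    simp only [zero_smul, add_zero]
    linarith [hg j hj]
  have ev3 : ∀ᶠ η in nhds (0 : ℝ), ∀ j ∈ I.setsOf e, η < I.grad p y j := by
    rw [Filter.eventually_all_finset]
    exact fun j hj => eventually_lt_nhds (hg j hj)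
  have evall := ((ev1.and (ev2.and ev3)).filter_mono nhdsWithin_le_nhds).and
    (self_mem_nhdsWithin (a := (0 : ℝ)) (s := Set.Ioi 0))
  obtain ⟨η, ⟨h1, h2, h3⟩, hη⟩ := evall.exists
  have hη0 : 0 < η := hη
  have hle : y ≤ y + η • v := le_add_of_nonneg_right (smul_nonneg hη0.le hv0)
  refine ⟨y + η • v, hle, fun j hj => by simp [hvoff j hj], h1.le, ?_, ?_⟩
  · refine Finset.sum_lt_sum_of_nonempty ⟨j0, mem_setsOf.2 hj0⟩ fun j hj => ?_
    have := mul_pos hη0 (hvpos j hj)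
    simpa using this
  -- The drift of the gradient gives a factor 2; the entries sum to less than 1 and the shifts `1 /
  -- d` to at most 1.
  · have hbound : I.energy p (y + η • v) - I.energy p y ≤ 4 * η := by
      refine (energy_sub_le hp hy0 hle).trans ?_
      have hrest : ∑ j, I.grad p (y + η • v) j * ((y + η • v) j - y j) =
          ∑ j ∈ I.setsOf e, I.grad p (y + η • v) j * ((y + η • v) j - y j) := by
        refine (Finset.sum_subset (Finset.subset_univ _) fun j _ hj => ?_).symm
        simp [hvoff j hj]
      rw [hrest]
      calc _ ≤ ∑ j ∈ I.setsOf e, 2 * η * (y j + δ) := by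
            refine Finset.sum_le_sum fun j hj => ?_
            have e1 : (y + η • v) j - y j = η * v j := by simp
            have e2 : I.grad p y j * v j = y j + δ := by
              rw [hvmem j hj]
              field_simp [(hg j hj).ne']
            rw [e1]
            calc _ ≤ 2 * I.grad p y j * (η * v j) :=
                  mul_le_mul_of_nonneg_right (h2 j hj).le (mul_nonneg hη0.le (hvpos j hj).le)
              _ = 2 * η * (I.grad p y j * v j) := by ring
              _ = _ := by rw [e2]
        _ = 2 * η * (∑ j ∈ I.setsOf e, y j + (I.setsOf e).card * δ) := by
            rw [← Finset.mul_sum, Finset.sum_add_distrib, Finset.sum_const, nsmul_eq_mul]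
        _ ≤ 2 * η * (1 + 1) := by
            gcongr
            rw [hδ, mul_one_div, div_le_one hd]
            exact_mod_cast card_setsOf_le e
        _ = 4 * η := by ring
    intro j hj
    refine hbound.trans ?_
    have hgj := hg j hj
    have hyj : 0 ≤ y j := hy0 j
    have hyδ : 0 < y j + δ := by linarith
    set u := η / I.grad p y j with hu
    have hu0 : 0 < u := div_pos hη0 hgj
    have hu1 : u ≤ 1 := (div_le_one hgj).2 (h3 j hj).le
    have hfac : (y + η • v) j + δ = (y j + δ) * (1 + u) := by
      simp only [Pi.add_apply, Pi.smul_apply, smul_eq_mul, hvmem j hj, hu]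
      ring
    rw [hfac, Real.log_mul hyδ.ne' (by linarith), add_sub_cancel_left]
    have hlog : u / 2 ≤ Real.log (1 + u) := by
      refine le_trans ?_ (Real.le_log_one_add_of_nonneg hu0.le)
      rw [div_le_div_iff₀ (by norm_num) (by linarith)]
      nlinarith
    have hmono := grad_mono hp hy0 hle j
    calc 4 * η = 8 * I.grad p y j * (u / 2) := by
          rw [hu]
          field_simp
          ring
      _ ≤ 8 * I.grad p (y + η • v) j * Real.log (1 + u) := by
          have := hgj.trans_le hmono
          gcongr

/-- Compactness replaces a differential equation: among the points that obey the charging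
inequality, one of maximal coverage must cover `e`, as otherwise a small step would improve it. -/
theorem exists_isUpdate {p : ℝ} (hp : 1 ≤ p) {e : Fin I.r} (he : ∃ j, e ∈ I.S j)
    {x : Fin I.n → ℝ} (hx0 : 0 ≤ x) (hx1 : x ≤ 1) (hfree : ∀ j, I.weight p j = 0 → x j = 1) :
    ∃ y, IsUpdate p e x y := by
  rcases le_or_gt 1 (∑ j ∈ I.setsOf e, x j) with hcov | hsum
  · exact ⟨x, le_rfl, hx1, hcov, fun j _ => by simp⟩
  -- A free set containing `e` has value 1 and would already cover it.
  have hpos : ∀ j ∈ I.setsOf e, 0 < I.weight p j := by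
    intro j hj
    refine (weight_nonneg p j).lt_of_ne fun h => hsum.not_ge ?_
    rw [← hfree j h.symm]
    exact Finset.single_le_sum (fun i _ => hx0 i) hj
  have hd : (0 : ℝ) < I.d := by
    obtain ⟨j, hj⟩ := he
    exact_mod_cast d_pos hj
  have hδ0 : (0 : ℝ) < 1 / I.d := by positivity
  let Q : Set (Fin I.n → ℝ) := {y | (y ∈ Set.Icc x 1 ∧ ∑ j ∈ I.setsOf e, y j ≤ 1) ∧
    ∀ j ∈ I.setsOf e, I.energy p y - I.energy p x ≤
      8 * I.grad p y j * (Real.log (y j + 1 / I.d) - Real.log (x j + 1 / I.d))}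
  have hQc : IsCompact Q := by
    refine (isCompact_Icc (a := x) (b := 1)).of_isClosed_subset ?_ fun y hy => hy.1.1
    have h1 : IsClosed {y : Fin I.n → ℝ | y ∈ Set.Icc x 1 ∧ ∑ j ∈ I.setsOf e, y j ≤ 1} :=
      isClosed_Icc.inter (isClosed_le (f := fun y : Fin I.n → ℝ => ∑ j ∈ I.setsOf e, y j)
        (by fun_prop) continuous_const)
    -- The box is repeated in each constraint because the logarithm is continuous only where its
    -- argument is nonzero.
    have h2 : Q = {y | y ∈ Set.Icc x 1 ∧ ∑ j ∈ I.setsOf e, y j ≤ 1} ∩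
        ⋂ j ∈ I.setsOf e, {y | y ∈ Set.Icc x 1 ∧ I.energy p y - I.energy p x ≤
          8 * I.grad p y j * (Real.log (y j + 1 / I.d) - Real.log (x j + 1 / I.d))} := by
      ext y
      simp only [Q, Set.mem_ofPred_eq, Set.mem_inter_iff, Set.mem_iInter]
      exact ⟨fun h => ⟨h.1, fun j hj => ⟨h.1.1, h.2 j hj⟩⟩, fun h => ⟨h.1, fun j hj => (h.2 j hj).2⟩⟩
    rw [h2]
    refine h1.inter (isClosed_biInter fun j _ => ?_)
    refine isClosed_Icc.isClosed_le ?_ ?_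
    · exact ((continuous_energy hp).sub continuous_const).continuousOn
    · refine (continuous_const.mul (continuous_grad hp j)).continuousOn.mul
        (ContinuousOn.sub (ContinuousOn.log (by fun_prop) fun y hy => ?_) continuousOn_const)
      have h3 : x j ≤ y j := hy.1 j
      have h4 : 0 ≤ x j := hx0 j
      exact (by linarith : 0 < y j + 1 / I.d).ne'
  have hxQ : x ∈ Q := ⟨⟨⟨le_rfl, hx1⟩, hsum.le⟩, fun j _ => by simp⟩
  obtain ⟨y, hyQ, hmax⟩ := hQc.exists_isMaxOn ⟨x, hxQ⟩
    (f := fun y : Fin I.n → ℝ => ∑ j ∈ I.setsOf e, y j)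
    (Continuous.continuousOn (by fun_prop))
  obtain ⟨⟨⟨hxy, hy1⟩, -⟩, hyE⟩ := hyQ
  refine ⟨y, hxy, hy1, ?_, hyE⟩
  by_contra! hlt
  have hy0 : 0 ≤ y := hx0.trans hxy
  obtain ⟨z, hyz, hoff, hz1, hz2, hzE⟩ := exists_small_step hp he hy0 hlt hpos
  have hz0 : 0 ≤ z := hy0.trans hyz
  refine (hmax (a := z) ⟨⟨⟨hxy.trans hyz, fun j => ?_⟩, hz1⟩, fun j hj => ?_⟩).not_gt hz2
  · by_cases hj : j ∈ I.setsOf e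
    · exact (Finset.single_le_sum (fun i _ => hz0 i) hj).trans hz1
    · rw [hoff j hj]
      exact hy1 j
  -- The two charges add up: the logarithms telescope, and the earlier gradient is at most the one
  -- at `z`.
  · have h1 := hyE j hj
    have h2 := hzE j hj
    have h3 := mul_le_mul_of_nonneg_right
      (mul_le_mul_of_nonneg_left (grad_mono hp hy0 hyz j) (by norm_num : (0 : ℝ) ≤ 8))
      (log_sub_log_nonneg hδ0 (hx0 j) (hxy j))
    linarith

open Classical in
/-- One step of the fractional algorithm. -/
noncomputable def step (p : ℝ) (x : Fin I.n → ℝ) (e : Fin I.r) : Fin I.n → ℝ :=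
  if h : ∃ y, IsUpdate p e x y then h.choose else x

variable (I) in
open Classical in
/-- The fractional algorithm starts by taking the sets of cost zero. -/
noncomputable def initial (p : ℝ) : Fin I.n → ℝ := fun j => if I.weight p j = 0 then 1 else 0

variable (I) in
/-- The fractional solution after the given requests. -/
noncomputable def fractional (p : ℝ) (σ : List (Fin I.r)) : Fin I.n → ℝ :=
  σ.foldl (step p) (I.initial p)

theorem fractional_append_singleton (p : ℝ) (σ : List (Fin I.r)) (e : Fin I.r) :
    I.fractional p (σ ++ [e]) = step p (I.fractional p σ) e := by
  simp [fractional]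

theorem step_isUpdate {p : ℝ} {x : Fin I.n → ℝ} {e : Fin I.r} (h : ∃ y, IsUpdate p e x y) :
    IsUpdate p e x (step p x e) := by
  rw [step, dif_pos h]
  exact h.choose_spec

theorem le_step (p : ℝ) (x : Fin I.n → ℝ) (e : Fin I.r) : x ≤ step p x e := by
  by_cases h : ∃ y, IsUpdate p e x y
  · exact (step_isUpdate h).le
  · rw [step, dif_neg h]

theorem step_le_one {p : ℝ} {x : Fin I.n → ℝ} (hx : x ≤ 1) (e : Fin I.r) : step p x e ≤ 1 := by
  by_cases h : ∃ y, IsUpdate p e x y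
  · exact (step_isUpdate h).le_one
  · rwa [step, dif_neg h]

theorem fractional_mono (p : ℝ) {σ τ : List (Fin I.r)} (h : σ <+: τ) :
    I.fractional p σ ≤ I.fractional p τ := by
  obtain ⟨ρ, rfl⟩ := h
  induction ρ using List.reverseRecOn with
  | nil => simp
  | append_singleton ρ e ih =>
    rw [← List.append_assoc, fractional_append_singleton]
    exact ih.trans (le_step _ _ _)

theorem initial_le_fractional (p : ℝ) (σ : List (Fin I.r)) :
    I.initial p ≤ I.fractional p σ :=
  fractional_mono p (List.nil_prefix)

theorem initial_nonneg (p : ℝ) : 0 ≤ I.initial p := fun j => by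
  simp only [initial]
  split_ifs <;> simp

theorem fractional_nonneg (p : ℝ) (σ : List (Fin I.r)) : 0 ≤ I.fractional p σ :=
  (initial_nonneg p).trans (initial_le_fractional p σ)

theorem fractional_le_one (p : ℝ) (σ : List (Fin I.r)) : I.fractional p σ ≤ 1 := by
  induction σ using List.reverseRecOn with
  | nil =>
    intro j
    simp only [fractional, List.foldl_nil, initial]
    split_ifs <;> simp
  | append_singleton σ e ih =>
    rw [fractional_append_singleton]
    exact step_le_one ih e

theorem fractional_isUpdate {p : ℝ} (hp : 1 ≤ p) (σ : List (Fin I.r)) {e : Fin I.r}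
    (he : ∃ j, e ∈ I.S j) : IsUpdate p e (I.fractional p σ) (I.fractional p (σ ++ [e])) := by
  rw [fractional_append_singleton]
  refine step_isUpdate (exists_isUpdate hp he (fractional_nonneg p σ) (fractional_le_one p σ)
    fun j hj => le_antisymm (fractional_le_one p σ j) ?_)
  refine le_trans ?_ (initial_le_fractional p σ j)
  simp [initial, hj]

theorem energy_initial {p : ℝ} (hp : 1 ≤ p) : I.energy p (I.initial p) = 0 := by
  have h1 : ∀ k, I.load (I.initial p) k = 0 := fun k => Finset.sum_eq_zero fun j _ => by
    by_cases h : I.weight p j = 0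
    · simp [(weight_eq_zero_iff hp).1 h k]
    · simp [initial, h]
  have h2 : ∀ j, I.weight p j * I.initial p j = 0 := fun j => by
    by_cases h : I.weight p j = 0
    · simp [h]
    · simp [initial, h]
  simp [energy, h1, h2, Real.zero_rpow (by linarith : p ≠ 0)]

/-- Each arrival is charged to one set of `T` containing it. Earlier charges may be restated with
the current gradient since gradients only grow. -/
theorem energy_fractional_le_sum {p : ℝ} (hp : 1 ≤ p) (hd : 0 < I.d) {T : Finset (Fin I.n)}
    {σ : List (Fin I.r)} (hT : ∀ e ∈ σ, I.Covers T e) :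
    I.energy p (I.fractional p σ) ≤ ∑ j ∈ T, 8 * I.grad p (I.fractional p σ) j *
      (Real.log (I.fractional p σ j + 1 / I.d) - Real.log (I.initial p j + 1 / I.d)) := by
  have hδ0 : (0 : ℝ) < 1 / I.d := by positivity
  induction σ using List.reverseRecOn with
  | nil =>
    have : I.fractional p [] = I.initial p := rfl
    simp [this, energy_initial hp]
  | append_singleton σ e ih =>
    obtain ⟨j0, hj0, hej0⟩ := hT e (by simp)
    have hup := fractional_isUpdate hp σ ⟨j0, hej0⟩
    have h1 := ih fun e' he' => hT e' (by simp [he'])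
    have h2 := hup.energy_le j0 (mem_setsOf.2 hej0)
    have hx0 := fractional_nonneg p σ
    have hy0 := fractional_nonneg p (σ ++ [e])
    set x := I.fractional p σ with hx
    set y := I.fractional p (σ ++ [e]) with hy
    have h3 : ∑ j ∈ T, 8 * I.grad p x j *
        (Real.log (x j + 1 / I.d) - Real.log (I.initial p j + 1 / I.d)) ≤
        ∑ j ∈ T, 8 * I.grad p y j *
        (Real.log (x j + 1 / I.d) - Real.log (I.initial p j + 1 / I.d)) := by
      refine Finset.sum_le_sum fun j _ => mul_le_mul_of_nonneg_right
        (mul_le_mul_of_nonneg_left (grad_mono hp hx0 hup.le j) (by norm_num)) ?_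
      exact log_sub_log_nonneg hδ0 (initial_nonneg p j) (initial_le_fractional p σ j)
    have h4 : 8 * I.grad p y j0 * (Real.log (y j0 + 1 / I.d) - Real.log (x j0 + 1 / I.d)) ≤
        ∑ j ∈ T, 8 * I.grad p y j * (Real.log (y j + 1 / I.d) - Real.log (x j + 1 / I.d)) :=
      Finset.single_le_sum (f := fun j => 8 * I.grad p y j *
          (Real.log (y j + 1 / I.d) - Real.log (x j + 1 / I.d)))
        (fun j _ => mul_nonneg (mul_nonneg (by norm_num) (grad_nonneg hp hy0 j))
          (log_sub_log_nonneg hδ0 (hx0 j) (hup.le j))) hj0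
    have h5 : ∑ j ∈ T, 8 * I.grad p y j *
        (Real.log (y j + 1 / I.d) - Real.log (I.initial p j + 1 / I.d)) =
        ∑ j ∈ T, 8 * I.grad p y j * (Real.log (y j + 1 / I.d) - Real.log (x j + 1 / I.d)) +
        ∑ j ∈ T, 8 * I.grad p y j *
          (Real.log (x j + 1 / I.d) - Real.log (I.initial p j + 1 / I.d)) := by
      rw [← Finset.sum_add_distrib]
      exact Finset.sum_congr rfl fun j _ => by ring
    linarith

/-- The fractional algorithm is `O(p log d)`-competitive. -/
theorem energy_fractional_le {p : ℝ} (hp : 1 ≤ p) (hd : 0 < I.d) {T : Finset (Fin I.n)}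
    {σ : List (Fin I.r)} (hT : ∀ e ∈ σ, I.Covers T e) :
    I.energy p (I.fractional p σ) ≤
      2 * (16 * Real.log (1 + I.d) * p) ^ p * ∑ k, (∑ j ∈ T, (I.B k j : ℝ)) ^ p := by
  have hd1 : (1 : ℝ) ≤ I.d := by exact_mod_cast hd
  have hd0 : (0 : ℝ) < I.d := by linarith
  set L := Real.log (1 + I.d) with hL
  have hL2 : 1 / 2 ≤ L := by
    have : Real.log 2 ≤ L := Real.log_le_log (by norm_num) (by linarith)
    linarith [Real.log_two_gt_d9]
  -- Chosen so that `8 * L * p = M / 2`; Young's inequality then returns exactly half of the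
  -- potential.
  set M := 16 * L * p with hM
  have hM8 : 8 ≤ M := by nlinarith
  have hM0 : 0 < M := by linarith
  set x := I.fractional p σ with hx
  have hx0 : 0 ≤ x := fractional_nonneg p σ
  -- The extreme ratio is `(1 + 1/d) / (1/d) = 1 + d`.
  have hlog : ∀ j, Real.log (x j + 1 / I.d) - Real.log (I.initial p j + 1 / I.d) ≤ L := by
    intro j
    have h1 : x j ≤ 1 := fractional_le_one p σ j
    have h0 : 0 ≤ x j := hx0 j
    have h2 : 0 ≤ I.initial p j := initial_nonneg p j
    have hδ : (0 : ℝ) < 1 / I.d := by positivity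
    rw [← Real.log_div (by linarith) (by linarith)]
    refine Real.log_le_log (div_pos (by linarith) (by linarith)) ?_
    rw [div_le_iff₀ (by linarith)]
    have h3 : (1 + (I.d : ℝ)) * (1 / I.d) = 1 / I.d + 1 := by field_simp
    nlinarith
  have h1 : I.energy p x ≤ 8 * L * ∑ j ∈ T, I.grad p x j := by
    refine (energy_fractional_le_sum hp hd hT).trans ?_
    rw [Finset.mul_sum]
    refine Finset.sum_le_sum fun j _ => ?_
    calc _ ≤ 8 * I.grad p x j * L := mul_le_mul_of_nonneg_left (hlog j)
          (mul_nonneg (by norm_num) (grad_nonneg hp hx0 j))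
      _ = _ := by ring
  set V := ∑ k, (∑ j ∈ T, (I.B k j : ℝ)) ^ p with hV
  have hu0 : ∀ k, 0 ≤ ∑ j ∈ T, (I.B k j : ℝ) := fun k => Finset.sum_nonneg fun j _ => (I.B k j).2
  have hV0 : 0 ≤ V := Finset.sum_nonneg fun k _ => Real.rpow_nonneg (hu0 k) _
  have h2 : ∑ j ∈ T, I.grad p x j =
      p * ∑ k, (∑ j ∈ T, (I.B k j : ℝ)) * I.load x k ^ (p - 1) + ∑ j ∈ T, I.weight p j := by
    unfold grad
    rw [Finset.sum_add_distrib, ← Finset.mul_sum, Finset.sum_comm]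
    simp_rw [Finset.sum_mul]
  have h3 : ∑ j ∈ T, I.weight p j ≤ V := by
    unfold weight
    rw [Finset.sum_comm]
    exact Finset.sum_le_sum fun k _ => Real.sum_rpow_le_rpow_sum hp T fun j => (I.B k j).2
  have h4 : ∑ k, (∑ j ∈ T, (I.B k j : ℝ)) * I.load x k ^ (p - 1) ≤
      I.energy p x / M + M ^ (p - 1) * V := by
    have h5 : ∑ k, I.load x k ^ p ≤ I.energy p x := by
      have : 0 ≤ ∑ j, I.weight p j * x j :=
        Finset.sum_nonneg fun j _ => mul_nonneg (weight_nonneg p j) (hx0 j)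
      unfold energy
      linarith
    calc _ ≤ ∑ k, (I.load x k ^ p / M + M ^ (p - 1) * (∑ j ∈ T, (I.B k j : ℝ)) ^ p) :=
          Finset.sum_le_sum fun k _ =>
            Real.mul_rpow_sub_one_le hp (hu0 k) (load_nonneg hx0 k) hM0
      _ = (∑ k, I.load x k ^ p) / M + M ^ (p - 1) * V := by
          rw [Finset.sum_add_distrib, Finset.sum_div, Finset.mul_sum]
      _ ≤ _ := by gcongr
  have h6 := Real.rpow_sub_one_mul_self hp hM0.le
  have h7 : M ≤ M ^ p := by
    conv_lhs => rw [← Real.rpow_one M]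
    exact Real.rpow_le_rpow_of_exponent_le (by linarith) hp
  have h8 : I.energy p x ≤ M / 2 * (I.energy p x / M + M ^ (p - 1) * V) + 8 * L * V := by
    calc I.energy p x ≤ 8 * L * (p * (I.energy p x / M + M ^ (p - 1) * V) + V) := by
          refine h1.trans ?_
          rw [h2]
          gcongr
      _ = _ := by rw [hM]; ring
  have h9 : M / 2 * (I.energy p x / M + M ^ (p - 1) * V) =
      I.energy p x / 2 + M ^ p * V / 2 := by
    rw [← h6]
    field_simp
  have h10 : 16 * L * V ≤ M ^ p * V := by
    refine mul_le_mul_of_nonneg_right (le_trans ?_ h7) hV0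
    rw [hM]
    nlinarith
  rw [h9] at h8
  linarith

end SetCoverInstance

/-! ### Uniform thresholds -/

namespace unitInterval

/-- This is `1 - t ≤ exp (-t)`. Values outside the unit interval are allowed because scaled
fractional values may exceed 1. -/
theorem volume_le_coe_le (t : ℝ) :
    volume {u : unitInterval | t ≤ (u : ℝ)} ≤ ENNReal.ofReal (Real.exp (-t)) := by
  rcases lt_or_ge t 0 with h0 | h0
  · refine prob_le_one.trans ?_
    rw [← ENNReal.ofReal_one]
    exact ENNReal.ofReal_le_ofReal (Real.one_le_exp (by linarith))
  rcases le_or_gt t 1 with h1 | h1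
  · have : {u : unitInterval | t ≤ (u : ℝ)} = Set.Ici ⟨t, h0, h1⟩ := rfl
    rw [this, unitInterval.volume_Ici]
    refine ENNReal.ofReal_le_ofReal ?_
    have := Real.add_one_le_exp (-t)
    simp only
    linarith
  · have : {u : unitInterval | t ≤ (u : ℝ)} = ∅ := by
      ext u
      simpa using lt_of_le_of_lt u.2.2 h1
    simp [this]

theorem integral_ite_coe_lt_le {t : ℝ} (h0 : 0 ≤ t) :
    ∫ u : unitInterval, (if (u : ℝ) < t then (1 : ℝ) else 0) ≤ t := by
  have hm : MeasurableSet {u : unitInterval | (u : ℝ) < t} :=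
    measurableSet_lt measurable_subtype_coe measurable_const
  have h1 : (fun u : unitInterval => if (u : ℝ) < t then (1 : ℝ) else 0) =
      {u : unitInterval | (u : ℝ) < t}.indicator 1 := by
    ext u
    simp [Set.indicator_apply]
  rw [h1, integral_indicator_one hm]
  refine ENNReal.toReal_le_of_le_ofReal h0 ?_
  rcases le_or_gt t 1 with h1 | h1
  · have : {u : unitInterval | (u : ℝ) < t} = Set.Iio ⟨t, h0, h1⟩ := rfl
    rw [this, unitInterval.volume_Iio]
  · refine prob_le_one.trans ?_
    rw [← ENNReal.ofReal_one]
    exact ENNReal.ofReal_le_ofReal h1.le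

end unitInterval

/-! ### The `ℓ_p` objective -/

namespace SetCoverInstance

variable {I : SetCoverInstance}

theorem sum_cost_nonneg (T : Finset (Fin I.n)) (k : Fin I.K) : 0 ≤ ∑ j ∈ T, (I.B k j : ℝ) :=
  Finset.sum_nonneg fun j _ => (I.B k j).2

theorem cost_nonneg (p : ℝ) (T : Finset (Fin I.n)) : 0 ≤ I.cost p T :=
  Real.rpow_nonneg (Finset.sum_nonneg fun k _ => Real.rpow_nonneg (sum_cost_nonneg T k) _) _

theorem cost_rpow {p : ℝ} (hp : 1 ≤ p) (T : Finset (Fin I.n)) :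
    I.cost p T ^ p = ∑ k, (∑ j ∈ T, (I.B k j : ℝ)) ^ p := by
  rw [cost, one_div, Real.rpow_inv_rpow
    (Finset.sum_nonneg fun k _ => Real.rpow_nonneg (sum_cost_nonneg T k) _) (by linarith)]

theorem cost_mono {p : ℝ} (hp : 1 ≤ p) {T T' : Finset (Fin I.n)} (h : T ⊆ T') :
    I.cost p T ≤ I.cost p T' := by
  rw [← Real.rpow_le_rpow_iff (cost_nonneg p T) (cost_nonneg p T') (by linarith : 0 < p),
    cost_rpow hp, cost_rpow hp]
  refine Finset.sum_le_sum fun k _ => Real.rpow_le_rpow (sum_cost_nonneg T k) ?_ (by linarith)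
  exact Finset.sum_le_sum_of_subset_of_nonneg h fun j _ _ => (I.B k j).2

theorem cost_empty {p : ℝ} (hp : 1 ≤ p) : I.cost p ∅ = 0 := by
  simp [cost, Real.zero_rpow (by linarith : p ≠ 0), Real.zero_rpow (by positivity : p⁻¹ ≠ 0)]

theorem cost_union_le {p : ℝ} (hp : 1 ≤ p) (T T' : Finset (Fin I.n)) :
    I.cost p (T ∪ T') ≤ I.cost p T + I.cost p T' := by
  have h := Real.Lp_add_le Finset.univ (fun k => ∑ j ∈ T, (I.B k j : ℝ))
    (fun k => ∑ j ∈ T', (I.B k j : ℝ)) hp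
  simp_rw [abs_of_nonneg (add_nonneg (sum_cost_nonneg T _) (sum_cost_nonneg T' _)),
    abs_of_nonneg (sum_cost_nonneg T _), abs_of_nonneg (sum_cost_nonneg T' _)] at h
  refine le_trans ?_ h
  refine Real.rpow_le_rpow
    (Finset.sum_nonneg fun k _ => Real.rpow_nonneg (sum_cost_nonneg _ k) _) ?_ (by positivity)
  refine Finset.sum_le_sum fun k _ => Real.rpow_le_rpow (sum_cost_nonneg _ k) ?_ (by linarith)
  rw [← Finset.sum_union_inter]
  exact le_add_of_nonneg_right (sum_cost_nonneg _ k)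

theorem cost_biUnion_le {p : ℝ} (hp : 1 ≤ p) {ι : Type*} (s : Finset ι)
    (F : ι → Finset (Fin I.n)) : I.cost p (s.biUnion F) ≤ ∑ i ∈ s, I.cost p (F i) := by
  classical
  induction s using Finset.induction_on with
  | empty => simp [cost_empty hp]
  | insert a s ha ih =>
    rw [Finset.biUnion_insert, Finset.sum_insert ha]
    exact (cost_union_le hp _ _).trans (by linarith)

theorem measurable_cost {Ω : Type*} [MeasurableSpace Ω] (p : ℝ) {s : Ω → Finset (Fin I.n)}
    (hs : ∀ j, MeasurableSet {ω | j ∈ s ω}) : Measurable fun ω => I.cost p (s ω) := by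
  have h : ∀ ω k, ∑ j ∈ s ω, (I.B k j : ℝ) = ∑ j, if j ∈ s ω then (I.B k j : ℝ) else 0 := by
    intro ω k
    rw [Finset.sum_ite_mem, Finset.univ_inter]
  simp only [cost, h]
  refine Measurable.pow_const (Finset.measurable_fun_sum _ fun k _ => Measurable.pow_const
    (Finset.measurable_fun_sum _ fun j _ => ?_) _) _
  exact Measurable.ite (hs j) measurable_const measurable_const

/-! ### Threshold rounding -/

variable (I) in
/-- The factor by which the fractional solution is scaled before it is rounded. -/
noncomputable def scale : ℝ := 2 * Real.log (1 + I.r)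

theorem scale_nonneg : 0 ≤ I.scale :=
  mul_nonneg (by norm_num) (Real.log_nonneg (by simp))

variable (I) in
/-- Threshold rounding of the fractional solution. -/
noncomputable def rounded (p : ℝ) (σ : List (Fin I.r)) (ω : Fin I.n → unitInterval) :
    Finset (Fin I.n) :=
  Finset.univ.filter fun j => (ω j : ℝ) < I.scale * I.fractional p σ j

theorem mem_rounded {p : ℝ} {σ : List (Fin I.r)} {ω : Fin I.n → unitInterval} {j : Fin I.n} :
    j ∈ I.rounded p σ ω ↔ (ω j : ℝ) < I.scale * I.fractional p σ j := by
  simp [rounded]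

theorem rounded_mono (p : ℝ) {σ τ : List (Fin I.r)} (h : σ <+: τ)
    (ω : Fin I.n → unitInterval) : I.rounded p σ ω ⊆ I.rounded p τ ω := by
  intro j hj
  rw [mem_rounded] at hj ⊢
  exact hj.trans_le (mul_le_mul_of_nonneg_left (fractional_mono p h j) scale_nonneg)

theorem measurableSet_mem_rounded (p : ℝ) (σ : List (Fin I.r)) (j : Fin I.n) :
    MeasurableSet {ω | j ∈ I.rounded p σ ω} := by
  simp only [mem_rounded]
  exact measurableSet_lt (measurable_subtype_coe.comp (measurable_pi_apply j)) measurable_const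

theorem integral_cost_rounded_le {p : ℝ} (hp : 1 ≤ p) (hd : 0 < I.d) (hr : 0 < I.r)
    {T : Finset (Fin I.n)} {σ : List (Fin I.r)} (hT : ∀ e ∈ σ, I.Covers T e) :
    ∫ ω, I.cost p (I.rounded p σ ω) ≤
      192 * p ^ 2 * I.scale * Real.log (1 + I.d) * I.cost p T := by
  have hp0 : 0 < p := by linarith
  have hp' : 0 ≤ p - 1 := by linarith
  have hr1 : (1 : ℝ) ≤ I.r := by exact_mod_cast hr
  have hd1 : (1 : ℝ) ≤ I.d := by exact_mod_cast hd
  set Λ := I.scale with hΛ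
  have hΛ1 : 1 ≤ Λ := by
    have : Real.log 2 ≤ Real.log (1 + I.r) := Real.log_le_log (by norm_num) (by linarith)
    rw [hΛ, scale]
    linarith [Real.log_two_gt_d9]
  have hΛ0 : 0 ≤ Λ := by linarith
  set L := Real.log (1 + I.d) with hL
  have hL0 : 0 ≤ L := Real.log_nonneg (by linarith)
  set x := I.fractional p σ with hx
  have hx0 : 0 ≤ x := fractional_nonneg p σ
  set X : Fin I.n → (Fin I.n → unitInterval) → ℝ :=
    fun j ω => if (ω j : ℝ) < Λ * x j then 1 else 0 with hX
  have hXm : ∀ j, Measurable fun u : unitInterval => if (u : ℝ) < Λ * x j then (1 : ℝ) else 0 :=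
    fun j => Measurable.ite (measurableSet_lt measurable_subtype_coe measurable_const)
      measurable_const measurable_const
  have hind : ProbabilityTheory.iIndepFun X (volume : Measure (Fin I.n → unitInterval)) :=
    ProbabilityTheory.iIndepFun_pi (μ := fun _ : Fin I.n => (volume : Measure unitInterval))
      (X := fun j (u : unitInterval) => if (u : ℝ) < Λ * x j then (1 : ℝ) else 0)
      fun j => (hXm j).aemeasurable
  have hq : ∀ j, ∫ ω, X j ω ≤ Λ * x j := by
    intro j
    have h1 : ∫ ω, X j ω = ∫ u : unitInterval, (if (u : ℝ) < Λ * x j then (1 : ℝ) else 0) :=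
      integral_comp_eval (μ := fun _ : Fin I.n => (volume : Measure unitInterval)) (i := j)
        (hXm j).aestronglyMeasurable
    rw [h1]
    exact unitInterval.integral_ite_coe_lt_le (mul_nonneg hΛ0 (hx0 j))
  have hq0 : ∀ j, 0 ≤ ∫ ω, X j ω := fun j => integral_nonneg fun ω => by
    simp only [hX, Pi.zero_apply]
    split_ifs <;> simp
  have hmom := fun k => integral_rpow_sum_bernoulli_le hp hind
    (fun j => (hXm j).comp (measurable_pi_apply j))
    (fun j ω => by simp only [hX]; split_ifs <;> simp) (b := fun j => (I.B k j : ℝ))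
    fun j => (I.B k j).2
  have hload : ∀ k ω, ∑ j ∈ I.rounded p σ ω, (I.B k j : ℝ) = ∑ j, (I.B k j : ℝ) * X j ω := by
    intro k ω
    rw [rounded, Finset.sum_filter]
    refine Finset.sum_congr rfl fun j _ => ?_
    simp [hX, hΛ, hx]
  have hcm := measurable_cost p (measurableSet_mem_rounded (I := I) p σ)
  have hci : Integrable (fun ω => I.cost p (I.rounded p σ ω)) :=
    Integrable.of_bound hcm.aestronglyMeasurable (I.cost p Finset.univ)
      (Filter.Eventually.of_forall fun ω => by
        rw [Real.norm_of_nonneg (cost_nonneg _ _)]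
        exact cost_mono hp (Finset.subset_univ _))
  have hci' : Integrable (fun ω => I.cost p (I.rounded p σ ω) ^ p) :=
    Integrable.of_bound (hcm.pow_const p).aestronglyMeasurable (I.cost p Finset.univ ^ p)
      (Filter.Eventually.of_forall fun ω => by
        rw [Real.norm_of_nonneg (Real.rpow_nonneg (cost_nonneg _ _) _)]
        exact Real.rpow_le_rpow (cost_nonneg _ _) (cost_mono hp (Finset.subset_univ _)) hp0.le)
  -- Jensen reduces the claim to the `p`-th moment, which splits over the cost functions.
  have hjensen : (∫ ω, I.cost p (I.rounded p σ ω)) ^ p ≤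
      ∫ ω, I.cost p (I.rounded p σ ω) ^ p :=
    ConvexOn.map_integral_le (convexOn_rpow hp)
      (Real.continuous_rpow_const hp0.le).continuousOn isClosed_Ici
      (Filter.Eventually.of_forall fun ω => cost_nonneg _ _) hci hci'
  have hki : ∀ k, Integrable fun ω => (∑ j, (I.B k j : ℝ) * X j ω) ^ p := by
    intro k
    have hm : Measurable fun ω => ∑ j, (I.B k j : ℝ) * X j ω :=
      Finset.measurable_fun_sum _ fun j _ =>
        ((hXm j).comp (measurable_pi_apply j)).const_mul _
    refine Integrable.of_bound (hm.pow_const p).aestronglyMeasurable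
      ((∑ j, (I.B k j : ℝ)) ^ p) (Filter.Eventually.of_forall fun ω => ?_)
    rw [← hload k ω, Real.norm_of_nonneg (Real.rpow_nonneg (sum_cost_nonneg _ k) _)]
    exact Real.rpow_le_rpow (sum_cost_nonneg _ k) (Finset.sum_le_sum_of_subset_of_nonneg
      (Finset.subset_univ _) fun j _ _ => (I.B k j).2) hp0.le
  have hsplit : ∫ ω, I.cost p (I.rounded p σ ω) ^ p =
      ∑ k, ∫ ω, (∑ j, (I.B k j : ℝ) * X j ω) ^ p := by
    rw [← integral_finsetSum _ fun k _ => hki k]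
    refine integral_congr_ae (Filter.Eventually.of_forall fun ω => ?_)
    simp only [cost_rpow hp, hload]
  -- Large enough that `D ^ p` dominates both coefficients of the moment bound, using `p + 1 ≤ 2 *
  -- p` and `Λ ≤ Λ ^ p`.
  set D := 6 * p * Λ with hD
  have hD0 : 0 ≤ D := by positivity
  have hc1 : (6 : ℝ) ^ p * Λ ^ p ≤ D ^ p := by
    rw [← Real.mul_rpow (by norm_num) hΛ0]
    refine Real.rpow_le_rpow (by positivity) ?_ hp0.le
    rw [hD]
    nlinarith
  have hc2 : 2 * (p + 1) ^ (p - 1) * Λ ≤ D ^ p := by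
    have h1 : (p + 1) ^ (p - 1) ≤ (2 * p) ^ (p - 1) :=
      Real.rpow_le_rpow (by linarith) (by linarith) hp'
    have h2 : (2 * p) ^ (p - 1) * (2 * p) = (2 * p) ^ p :=
      Real.rpow_sub_one_mul_self hp (by linarith)
    have h3 : 0 ≤ (2 * p) ^ (p - 1) := Real.rpow_nonneg (by linarith) _
    have h4 : Λ ≤ Λ ^ p := by
      conv_lhs => rw [← Real.rpow_one Λ]
      exact Real.rpow_le_rpow_of_exponent_le hΛ1 hp
    calc 2 * (p + 1) ^ (p - 1) * Λ ≤ (2 * p) ^ p * Λ ^ p := by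
          refine mul_le_mul ?_ h4 hΛ0 (by positivity)
          nlinarith
      _ = (2 * p * Λ) ^ p := (Real.mul_rpow (by positivity) hΛ0).symm
      _ ≤ D ^ p := by
        refine Real.rpow_le_rpow (by positivity) ?_ hp0.le
        rw [hD]
        gcongr
        norm_num
  have hG : ∑ k, ∫ ω, (∑ j, (I.B k j : ℝ) * X j ω) ^ p ≤ D ^ p * I.energy p x := by
    have h1 : ∀ k, ∫ ω, (∑ j, (I.B k j : ℝ) * X j ω) ^ p ≤ D ^ p * I.load x k ^ p +
        D ^ p * ∑ j, (I.B k j : ℝ) ^ p * x j := by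
      intro k
      refine (hmom k).trans (add_le_add ?_ ?_)
      · calc _ ≤ 6 ^ p * (Λ * I.load x k) ^ p := by
              refine mul_le_mul_of_nonneg_left (Real.rpow_le_rpow (Finset.sum_nonneg fun j _ =>
                mul_nonneg (I.B k j).2 (hq0 j)) ?_ hp0.le) (by positivity)
              rw [load, Finset.mul_sum]
              refine Finset.sum_le_sum fun j _ => ?_
              calc _ ≤ (I.B k j : ℝ) * (Λ * x j) := mul_le_mul_of_nonneg_left (hq j) (I.B k j).2
                _ = _ := by ring
          _ = 6 ^ p * Λ ^ p * I.load x k ^ p := by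
              rw [Real.mul_rpow hΛ0 (load_nonneg hx0 k)]
              ring
          _ ≤ _ := mul_le_mul_of_nonneg_right hc1 (Real.rpow_nonneg (load_nonneg hx0 k) _)
      · calc _ ≤ 2 * (p + 1) ^ (p - 1) * (Λ * ∑ j, (I.B k j : ℝ) ^ p * x j) := by
              refine mul_le_mul_of_nonneg_left ?_ (by positivity)
              rw [Finset.mul_sum]
              refine Finset.sum_le_sum fun j _ => ?_
              calc _ ≤ (I.B k j : ℝ) ^ p * (Λ * x j) :=
                    mul_le_mul_of_nonneg_left (hq j) (by positivity)
                _ = _ := by ring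
          _ = 2 * (p + 1) ^ (p - 1) * Λ * ∑ j, (I.B k j : ℝ) ^ p * x j := by ring
          _ ≤ _ := mul_le_mul_of_nonneg_right hc2
              (Finset.sum_nonneg fun j _ => mul_nonneg (by positivity) (hx0 j))
    refine (Finset.sum_le_sum fun k _ => h1 k).trans_eq ?_
    rw [Finset.sum_add_distrib, ← Finset.mul_sum, ← Finset.mul_sum, energy, Finset.sum_comm,
      mul_add]
    simp_rw [weight, Finset.sum_mul]
  have hE := energy_fractional_le hp hd hT
  rw [← cost_rpow hp] at hE
  -- The constant is `6 * 2 * 16 = 192`: rounding, then `2 ≤ 2 ^ p`, then the fractional bound.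
  have hfin : (∫ ω, I.cost p (I.rounded p σ ω)) ^ p ≤
      (192 * p ^ 2 * Λ * L * I.cost p T) ^ p := by
    calc _ ≤ D ^ p * I.energy p x := (hjensen.trans_eq hsplit).trans hG
      _ ≤ D ^ p * (2 ^ p * (16 * L * p) ^ p * I.cost p T ^ p) := by
          have h2 : (2 : ℝ) ≤ 2 ^ p := by
            conv_lhs => rw [← Real.rpow_one 2]
            exact Real.rpow_le_rpow_of_exponent_le (by norm_num) hp
          have h3 : 0 ≤ (16 * L * p) ^ p := by positivity
          have h4 : 0 ≤ I.cost p T ^ p := Real.rpow_nonneg (cost_nonneg _ _) _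
          refine mul_le_mul_of_nonneg_left (hE.trans ?_) (by positivity)
          gcongr
      _ = _ := by
          have hO := cost_nonneg p T
          rw [← Real.mul_rpow (by norm_num) (by positivity), ← Real.mul_rpow (by positivity) hO,
            ← Real.mul_rpow hD0 (by positivity)]
          congr 1
          rw [hD]
          ring
  exact (Real.rpow_le_rpow_iff (integral_nonneg fun ω => cost_nonneg _ _)
    (mul_nonneg (by positivity) (cost_nonneg _ _)) hp0).1 hfin

/-! ### Repairing missed elements -/

variable (I) in
open Classical in
/-- A cheapest set containing the element `e`, if there is one. -/
noncomputable def cheapest (p : ℝ) (e : Fin I.r) : Finset (Fin I.n) :=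
  if h : ∃ j, e ∈ I.S j ∧ ∀ i, e ∈ I.S i → I.cost p {j} ≤ I.cost p {i} then {h.choose} else ∅

theorem covers_cheapest (p : ℝ) {e : Fin I.r} (he : ∃ j, e ∈ I.S j) :
    I.Covers (I.cheapest p e) e := by
  obtain ⟨j0, hj0⟩ := he
  have h : ∃ j, e ∈ I.S j ∧ ∀ i, e ∈ I.S i → I.cost p {j} ≤ I.cost p {i} := by
    obtain ⟨j, hj, hmin⟩ := Finset.exists_min_image (I.setsOf e) (fun j => I.cost p {j})
      ⟨j0, mem_setsOf.2 hj0⟩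
    exact ⟨j, mem_setsOf.1 hj, fun i hi => hmin i (mem_setsOf.2 hi)⟩
  rw [cheapest, dif_pos h]
  exact ⟨_, Finset.mem_singleton_self _, h.choose_spec.1⟩

theorem cost_cheapest_le {p : ℝ} (hp : 1 ≤ p) {e : Fin I.r} {T : Finset (Fin I.n)}
    (hT : I.Covers T e) : I.cost p (I.cheapest p e) ≤ I.cost p T := by
  obtain ⟨i, hiT, hi⟩ := hT
  unfold cheapest
  split_ifs with h
  · exact (h.choose_spec.2 i hi).trans (cost_mono hp (Finset.singleton_subset_iff.2 hiT))
  · rw [cost_empty hp]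
    exact cost_nonneg p T

variable (I) in
/-- At some arrival of `e`, the rounded solution did not cover it. -/
def Missed (p : ℝ) (σ : List (Fin I.r)) (ω : Fin I.n → unitInterval) (e : Fin I.r) : Prop :=
  ∃ τ, τ ++ [e] <+: σ ∧ ¬ I.Covers (I.rounded p (τ ++ [e]) ω) e

theorem Missed.mem {p : ℝ} {σ : List (Fin I.r)} {ω : Fin I.n → unitInterval} {e : Fin I.r}
    (h : I.Missed p σ ω e) : e ∈ σ := by
  obtain ⟨τ, hτ, -⟩ := h
  exact hτ.subset (by simp)

theorem measurableSet_missed (p : ℝ) (σ : List (Fin I.r)) (e : Fin I.r) :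
    MeasurableSet {ω | I.Missed p σ ω e} := by
  refine measurableSet_setOfPred.2 (Measurable.exists fun τ => measurable_const.and
    (Measurable.not (Measurable.exists fun j => ?_)))
  exact (measurableSet_setOfPred.1 (measurableSet_mem_rounded p (τ ++ [e]) j)).and measurable_const

/-- By independence the miss probabilities multiply, so the exponents sum to at least the scale once
`e` is fractionally covered. -/
theorem volume_not_covers_rounded_le {p : ℝ} {σ : List (Fin I.r)} {e : Fin I.r}
    (hcov : 1 ≤ ∑ j ∈ I.setsOf e, I.fractional p σ j) :
    volume {ω | ¬ I.Covers (I.rounded p σ ω) e} ≤ ENNReal.ofReal (Real.exp (-I.scale)) := by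
  classical
  set x := I.fractional p σ with hx
  let t : Fin I.n → Set unitInterval := fun j =>
    if j ∈ I.setsOf e then {u | I.scale * x j ≤ (u : ℝ)} else Set.univ
  have hset : {ω | ¬ I.Covers (I.rounded p σ ω) e} ⊆ Set.univ.pi t := by
    intro ω hω j _
    by_cases hj : j ∈ I.setsOf e
    · simp only [t, if_pos hj]
      refine not_lt.1 fun h => hω ⟨j, mem_rounded.2 h, mem_setsOf.1 hj⟩
    · simp only [t, if_neg hj]
      exact Set.mem_univ _
  refine (measure_mono hset).trans ?_
  rw [volume_pi_pi]
  calc ∏ j, volume (t j)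
      ≤ ∏ j, ENNReal.ofReal (Real.exp (-(if j ∈ I.setsOf e then I.scale * x j else 0))) := by
        refine Finset.prod_le_prod' fun j _ => ?_
        by_cases hj : j ∈ I.setsOf e
        · simp only [t, if_pos hj]
          exact unitInterval.volume_le_coe_le _
        · simp only [t, if_neg hj]
          simp
    _ = ENNReal.ofReal (Real.exp (-(I.scale * ∑ j ∈ I.setsOf e, x j))) := by
        rw [← ENNReal.ofReal_prod_of_nonneg fun j _ => (Real.exp_pos _).le, ← Real.exp_sum,
          Finset.sum_neg_distrib, Finset.sum_ite_mem, Finset.univ_inter, Finset.mul_sum]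
    _ ≤ _ := by
        refine ENNReal.ofReal_le_ofReal (Real.exp_le_exp.2 (neg_le_neg ?_))
        exact le_mul_of_one_le_right scale_nonneg hcov

/-- Thresholds are fixed, so the rounded solution only grows and a miss at any arrival forces a miss
at the first one; repeated requests cost no extra probability. -/
theorem volume_missed_le {p : ℝ} (hp : 1 ≤ p) {σ : List (Fin I.r)} (hσ : I.Feasible σ)
    (e : Fin I.r) :
    volume {ω | I.Missed p σ ω e} ≤ ENNReal.ofReal (Real.exp (-I.scale)) := by
  by_cases he : e ∈ σ
  swap
  · have : {ω | I.Missed p σ ω e} = ∅ := by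
      ext ω
      simpa using fun h : I.Missed p σ ω e => he h.mem
    simp [this]
  obtain ⟨τ, ρ, hsplit, hτ⟩ := List.eq_append_cons_of_mem he
  have hpre : τ ++ [e] <+: σ := ⟨ρ, by simp [hsplit]⟩
  refine (measure_mono fun ω hω => ?_).trans
    (volume_not_covers_rounded_le (fractional_isUpdate hp τ (hσ e he)).covers)
  obtain ⟨τ', hτ', hmiss⟩ := hω
  intro hcov
  have hle : τ ++ [e] <+: τ' ++ [e] := by
    rcases List.prefix_or_prefix_of_prefix hpre hτ' with h | h
    · exact h
    · rcases List.prefix_concat_iff.1 h with h | h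
      · rw [h]
      · exact absurd (h.subset (by simp)) hτ
  obtain ⟨j, hj, hej⟩ := hcov
  exact hmiss ⟨j, rounded_mono p hle ω hj, hej⟩

variable (I) in
open Classical in
/-- The online algorithm: round the fractional solution with fixed thresholds, and cover an
element that is missed by a cheapest set. -/
noncomputable def selection (p : ℝ) (σ : List (Fin I.r)) (ω : Fin I.n → unitInterval) :
    Finset (Fin I.n) :=
  I.rounded p σ ω ∪ (Finset.univ.filter fun e => I.Missed p σ ω e).biUnion (I.cheapest p)

theorem mem_selection {p : ℝ} {σ : List (Fin I.r)} {ω : Fin I.n → unitInterval} {j : Fin I.n} :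
    j ∈ I.selection p σ ω ↔
      j ∈ I.rounded p σ ω ∨ ∃ e, I.Missed p σ ω e ∧ j ∈ I.cheapest p e := by
  simp [selection]

variable (I) in
/-- The randomized online algorithm with independent uniform thresholds. -/
noncomputable def onlineAlgorithm (p : ℝ) : RandomizedOnlineSetCover I where
  Ω := Fin I.n → unitInterval
  P := volume
  select := I.selection p
  measurable_select σ j := by
    simp only [mem_selection]
    refine measurableSet_setOfPred.2 (Measurable.or ?_ (Measurable.exists fun e => ?_))
    · exact measurableSet_setOfPred.1 (measurableSet_mem_rounded p σ j)
    · exact (measurableSet_setOfPred.1 (measurableSet_missed p σ e)).and measurable_const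
  irrevocable σ e ω j hj := by
    have hpre : σ <+: σ ++ [e] := List.prefix_append _ _
    rw [mem_selection] at hj ⊢
    rcases hj with hj | ⟨e', ⟨τ, hτ, hm⟩, hj⟩
    · exact Or.inl (rounded_mono p hpre ω hj)
    · exact Or.inr ⟨e', ⟨τ, hτ.trans hpre, hm⟩, hj⟩
  covers_arrival σ e ω he := by
    by_cases h : I.Covers (I.rounded p (σ ++ [e]) ω) e
    · obtain ⟨j, hj, hej⟩ := h
      exact ⟨j, mem_selection.2 (Or.inl hj), hej⟩
    · obtain ⟨j, hj, hej⟩ := covers_cheapest p he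
      exact ⟨j, mem_selection.2 (Or.inr ⟨e, ⟨σ, List.prefix_rfl, h⟩, hj⟩), hej⟩

theorem expectedCost_onlineAlgorithm (p : ℝ) (σ : List (Fin I.r)) :
    (I.onlineAlgorithm p).expectedCost p σ = ∫ ω, I.cost p (I.selection p σ ω) := rfl

/-- Needed separately: with no request the optimum is 0, and the positivity of `d` and `r` cannot be
read off an arriving element. -/
theorem cost_selection_nil {p : ℝ} (hp : 1 ≤ p) (ω : Fin I.n → unitInterval) :
    I.cost p (I.selection p [] ω) = 0 := by
  have h : ∀ k, ∑ j ∈ I.selection p [] ω, (I.B k j : ℝ) = 0 := by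
    refine fun k => Finset.sum_eq_zero fun j hj => ?_
    rcases mem_selection.1 hj with hj | ⟨e, he, -⟩
    · by_cases hw : I.weight p j = 0
      · simp [(weight_eq_zero_iff hp).1 hw k]
      · have h1 : I.fractional p [] j = 0 := if_neg hw
        rw [mem_rounded, h1, mul_zero] at hj
        exact absurd hj (not_lt.2 (ω j).2.1)
    · exact absurd he.mem List.not_mem_nil
  simp [cost, h, Real.zero_rpow (by linarith : p ≠ 0), Real.zero_rpow (by positivity : p⁻¹ ≠ 0)]

theorem exp_neg_scale_mul_le : (I.r : ℝ) * Real.exp (-I.scale) ≤ 1 := by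
  have h1 : (0 : ℝ) < 1 + I.r := by positivity
  have h2 : Real.exp (-I.scale) ≤ Real.exp (-Real.log (1 + I.r)) := by
    refine Real.exp_le_exp.2 (neg_le_neg ?_)
    have : 0 ≤ Real.log (1 + I.r) := Real.log_nonneg (by simp)
    rw [scale]
    linarith
  rw [Real.exp_neg (Real.log _), Real.exp_log h1] at h2
  calc (I.r : ℝ) * Real.exp (-I.scale) ≤ I.r * (1 + (I.r : ℝ))⁻¹ := by gcongr
    _ ≤ 1 := by
      rw [← div_eq_mul_inv, div_le_one h1]
      linarith

/-- Minkowski separates rounding from repairs. Each repair costs at most `T`, which itself contains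
a set covering the element, and the expected number of missed elements is at most 1. -/
theorem integral_cost_selection_le {p : ℝ} (hp : 1 ≤ p) (hd : 0 < I.d) (hr : 0 < I.r)
    {T : Finset (Fin I.n)} {σ : List (Fin I.r)} (hσ : I.Feasible σ)
    (hT : ∀ e ∈ σ, I.Covers T e) :
    ∫ ω, I.cost p (I.selection p σ ω) ≤
      (192 * p ^ 2 * I.scale * Real.log (1 + I.d) + 1) * I.cost p T := by
  classical
  have hO := cost_nonneg p T
  have hle : ∀ ω, I.cost p (I.selection p σ ω) ≤ I.cost p (I.rounded p σ ω) +
      ∑ e, {ω | I.Missed p σ ω e}.indicator (fun _ => I.cost p T) ω := by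
    intro ω
    refine (cost_union_le hp _ _).trans (add_le_add le_rfl ((cost_biUnion_le hp _ _).trans ?_))
    rw [Finset.sum_filter]
    refine Finset.sum_le_sum fun e _ => ?_
    by_cases h : I.Missed p σ ω e
    · rw [if_pos h, Set.indicator_of_mem (by exact h)]
      exact cost_cheapest_le hp (hT e h.mem)
    · rw [if_neg h, Set.indicator_of_notMem (by exact h)]
  have hci : Integrable (fun ω => I.cost p (I.rounded p σ ω)) :=
    Integrable.of_bound
      (measurable_cost p (measurableSet_mem_rounded (I := I) p σ)).aestronglyMeasurable
      (I.cost p Finset.univ) (Filter.Eventually.of_forall fun ω => by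
        rw [Real.norm_of_nonneg (cost_nonneg _ _)]
        exact cost_mono hp (Finset.subset_univ _))
  have hmi : ∀ e, Integrable ({ω | I.Missed p σ ω e}.indicator (fun _ => I.cost p T)) :=
    fun e => (integrable_const _).indicator (measurableSet_missed p σ e)
  have hsi := integrable_finsetSum Finset.univ fun e (_ : e ∈ Finset.univ) => hmi e
  have hmiss : ∀ e, ∫ ω, {ω | I.Missed p σ ω e}.indicator (fun _ => I.cost p T) ω ≤
      Real.exp (-I.scale) * I.cost p T := by
    intro e
    rw [integral_indicator_const _ (measurableSet_missed p σ e), smul_eq_mul]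
    exact mul_le_mul_of_nonneg_right
      (ENNReal.toReal_le_of_le_ofReal (Real.exp_pos _).le (volume_missed_le hp hσ e)) hO
  calc ∫ ω, I.cost p (I.selection p σ ω)
      ≤ ∫ ω, (I.cost p (I.rounded p σ ω) +
          ∑ e, {ω | I.Missed p σ ω e}.indicator (fun _ => I.cost p T) ω) :=
        integral_mono_of_nonneg (Filter.Eventually.of_forall fun ω => cost_nonneg _ _)
          (hci.add hsi) (Filter.Eventually.of_forall hle)
    _ = (∫ ω, I.cost p (I.rounded p σ ω)) +
          ∑ e, ∫ ω, {ω | I.Missed p σ ω e}.indicator (fun _ => I.cost p T) ω := by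
        rw [integral_add hci hsi, integral_finsetSum _ fun e _ => hmi e]
    _ ≤ 192 * p ^ 2 * I.scale * Real.log (1 + I.d) * I.cost p T +
          ∑ _e : Fin I.r, Real.exp (-I.scale) * I.cost p T :=
        add_le_add (integral_cost_rounded_le hp hd hr hT) (Finset.sum_le_sum fun e _ => hmiss e)
    _ = 192 * p ^ 2 * I.scale * Real.log (1 + I.d) * I.cost p T +
          (I.r * Real.exp (-I.scale)) * I.cost p T := by
        simp [mul_assoc]
    _ ≤ 192 * p ^ 2 * I.scale * Real.log (1 + I.d) * I.cost p T + 1 * I.cost p T := by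
        gcongr
        exact exp_neg_scale_mul_le
    _ = _ := by ring

/-! ### The offline optimum and the conclusion -/

theorem exists_cost_eq_opt (p : ℝ) {σ : List (Fin I.r)} (hσ : I.Feasible σ) :
    ∃ T : Finset (Fin I.n), (∀ e ∈ σ, I.Covers T e) ∧ I.opt p σ = I.cost p T := by
  have hne : {c : ℝ | ∃ T : Finset (Fin I.n), (∀ e ∈ σ, I.Covers T e) ∧
      c = I.cost p T}.Nonempty :=
    ⟨_, Finset.univ, fun e he => (hσ e he).imp fun j hj => ⟨Finset.mem_univ j, hj⟩, rfl⟩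
  refine hne.csInf_mem ((Set.finite_range fun T : Finset (Fin I.n) => I.cost p T).subset ?_)
  rintro c ⟨T, -, rfl⟩
  exact ⟨T, rfl⟩

theorem opt_nil {p : ℝ} (hp : 1 ≤ p) : I.opt p [] = 0 := by
  refine le_antisymm (csInf_le ⟨0, ?_⟩ ⟨∅, by simp, (cost_empty hp).symm⟩) ?_
  · rintro c ⟨T, -, rfl⟩
    exact cost_nonneg p T
  · obtain ⟨T, -, h⟩ := exists_cost_eq_opt (I := I) p (σ := []) (by simp [Feasible])
    rw [h]
    exact cost_nonneg p T

end SetCoverInstance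

theorem mainTheorem5 :
    ∃ C : ℝ, 0 < C ∧
      ∃ A : (p : ℝ) → (I : SetCoverInstance) → RandomizedOnlineSetCover I,
        ∀ (p : ℝ), 1 ≤ p → ∀ I : SetCoverInstance,
          (A p I).IsCompetitive p
            (C * (p ^ 3 / Real.log (1 + p) * Real.log (1 + (I.d : ℝ)) *
              Real.log (1 + (I.r : ℝ)))) := by
  refine ⟨400, by norm_num, fun p I => I.onlineAlgorithm p, fun p hp I σ hσ => ?_⟩
  rw [SetCoverInstance.expectedCost_onlineAlgorithm]
  rcases σ.eq_nil_or_concat with rfl | ⟨σ', e, hσe⟩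
  · simp [SetCoverInstance.cost_selection_nil hp, SetCoverInstance.opt_nil hp]
  have he : e ∈ σ := by simp [hσe]
  obtain ⟨j, hj⟩ := hσ e he
  have hd : 0 < I.d := SetCoverInstance.d_pos hj
  have hr : 0 < I.r := e.pos
  obtain ⟨T, hT, hopt⟩ := SetCoverInstance.exists_cost_eq_opt p hσ
  rw [hopt]
  refine (SetCoverInstance.integral_cost_selection_le hp hd hr hσ hT).trans
    (mul_le_mul_of_nonneg_right ?_ (SetCoverInstance.cost_nonneg p T))
  have hhalf : ∀ m : ℕ, 0 < m → 1 / 2 ≤ Real.log (1 + (m : ℝ)) := by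
    intro m hm
    have h1 : (1 : ℝ) ≤ m := by exact_mod_cast hm
    have h2 : Real.log 2 ≤ Real.log (1 + m) := Real.log_le_log (by norm_num) (by linarith)
    linarith [Real.log_two_gt_d9]
  have hL := hhalf _ hd
  have hR := hhalf _ hr
  rw [SetCoverInstance.scale]
  set L := Real.log (1 + (I.d : ℝ))
  set R := Real.log (1 + (I.r : ℝ))
  have hlogp : 0 < Real.log (1 + p) := Real.log_pos (by linarith)
  -- Passing from `p ^ 2` to the stated rate only uses `log (1 + p) ≤ p`.
  have hp2 : p ^ 2 ≤ p ^ 3 / Real.log (1 + p) := by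
    rw [le_div_iff₀ hlogp]
    have : Real.log (1 + p) ≤ p := by
      have := Real.log_le_sub_one_of_pos (by linarith : 0 < 1 + p)
      linarith
    calc p ^ 2 * Real.log (1 + p) ≤ p ^ 2 * p := by gcongr
      _ = p ^ 3 := by ring
  have hLR : 1 / 4 ≤ L * R := by nlinarith
  -- The slack `400 - 384 = 16` pays for the repairs, as `L * R ≥ 1 / 4` and `p ≥ 1`.
  calc 192 * p ^ 2 * (2 * R) * L + 1 ≤ 400 * (p ^ 2 * L * R) := by nlinarith
    _ ≤ _ := by gcongr
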